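/- Let $m\ge 1$ be an integer and let $C_{2m+1}$ be the cycle with vertices $v_1,\dots,v_{2m+1}$ in cyclic order and sink $q=v_{2m+1}$. Let $-C_{2m+1}$ be the signed graph on $C_{2m+1}$ in which every edge not incident to $q$ is negative and the two edges incident to $q$ are positive. Put $n=2m$. Let $M$ be the reduced Laplacian of $C_{2m+1}$ (the $n\times n$ matrix with $M_{ii}=2$, $M_{ij}=-1$ if $|i-j|=1$, and $M_{ij}=0$ otherwise), and let $L$ be the reduced signed Laplacian of $-C_{2m+1}$ ($L_{ii}=2$, $L_{ij}=+1$ if $|i-j|=1$, and $L_{ij}=0$ otherwise). Let $\mathcal K(-C_{2m+1})=\mathbb Z^{n}/\operatorname{im}L$ be the critical group. Let $S^+=\{LM^{-1}x : x\in\mathbb R^n_{\ge 0},\ LM^{-1}x\in\mathbb Z^n\}$ be the set of valid configurations. A configuration $c\in S^+$ is - $z$-superstable if $c-Lz\notin S^+$ for all nonzero $z\in\mathbb Z^n_{\ge0}$; - stable if $c-Le_i\notin S^+$ for all $i=1,\dots,n$, where $e_i$ is the $i$th standard basis vector; - reachable if there is $d\in S^+$ with $d-Le_i\in S^+$ for all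 $i$, and a finite (possibly empty) sequence of indices $i_1,\dots,i_k$ such that $d-\sum_{j\le \ell}Le_{i_j}\in S^+$ for all $\ell\le k$ and $c=d-\sum_{j\le k}Le_{i_j}$; - critical if it is stable and reachable. Theorem. There is exactly one critical configuration $e_{-C_{2m+1}}$ in $\operatorname{im}L$, that is, exactly one critical configuration that represents the identity of $\mathcal K(-C_{2m+1})$. The map $$\Delta:\{z\text{-superstable configurations of }-C_{2m+1}\}\to\{\text{critical configurations of }-C_{2m+1}\},\qquad c\mapsto e_{-C_{2m+1}}+c,$$ is a bijection. -/

import Mathlib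

/-- A signed graph: a simple graph with a sign `+1` or `-1` on each edge. -/
structure SignedGraph (V : Type*) where
  graph : SimpleGraph V
  sign : graph.edgeSet → ℤˣ

namespace SignedGraph

/-- `|G|`: the graph `G` with all edges positive. -/
def allPositive {V : Type*} (G : SimpleGraph V) : SignedGraph V where
  graph := G
  sign := fun _ => 1

open Classical in
/-- `-G`, relative to a sink `q`: every edge not incident to `q` is negative,
every edge incident to `q` is positive. -/
noncomputable def negative {V : Type*} (G : SimpleGraph V) (q : V) : SignedGraph V where
  graph := G
  sign := fun e => if q ∈ (e : Sym2 V) then 1 else -1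

open Classical in
/-- The signed Laplacian: degrees on the diagonal, and off the diagonal `-1` for a positive edge,
`+1` for a negative edge, `0` for a non-edge. -/
noncomputable def laplacian {V : Type*} [Fintype V] (S : SignedGraph V) : Matrix V V ℤ :=
  Matrix.of fun i j =>
    if i = j then (S.graph.degree i : ℤ)
    else if h : S.graph.Adj i j then -((S.sign ⟨s(i, j), h⟩ : ℤˣ) : ℤ)
    else 0

/-- The reduced signed Laplacian of a signed graph on vertices `0, …, n`, the sink being the last
vertex `n`: the row and the column of the sink are removed. -/
noncomputable def reducedLaplacian {n : ℕ} (S : SignedGraph (Fin (n + 1))) :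
    Matrix (Fin n) (Fin n) ℤ :=
  S.laplacian.submatrix Fin.castSucc Fin.castSucc

/-- The critical group `ℤⁿ / im L`, where `L` is the reduced signed Laplacian. -/
abbrev CriticalGroup {n : ℕ} (S : SignedGraph (Fin (n + 1))) : Type :=
  (Fin n → ℤ) ⧸ LinearMap.range S.reducedLaplacian.mulVecLin

end SignedGraph

/-! Chip-firing for a pair `(L, M)` of invertible matrices, `M` being an M-matrix. -/
namespace ChipFiring

variable {n : ℕ} (L M : Matrix (Fin n) (Fin n) ℤ)

/-- `c` lies in `S⁺`: it is an integer vector of the form `L M⁻¹ x` with `x ≥ 0` real. -/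
def IsValid (c : Fin n → ℤ) : Prop :=
  ∃ x : Fin n → ℝ, (∀ i, 0 ≤ x i) ∧
    (fun i => (c i : ℝ)) =
      Matrix.mulVec (L.map (Int.cast : ℤ → ℝ) * (M.map (Int.cast : ℤ → ℝ))⁻¹) x

/-- The result of firing the site `i` once: `c - L eᵢ`. -/
def fire (c : Fin n → ℤ) (i : Fin n) : Fin n → ℤ :=
  c - Matrix.mulVec L (Pi.single i 1)

/-- `c` is valid and no site is ready to fire. -/
def IsStable (c : Fin n → ℤ) : Prop :=
  IsValid L M c ∧ ∀ i, ¬ IsValid L M (fire L c i)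

/-- `c` is valid and no nonempty multiset of sites can be fired. -/
def IsZSuperstable (c : Fin n → ℤ) : Prop :=
  IsValid L M c ∧
    ∀ z : Fin n → ℤ, (∀ i, 0 ≤ z i) → z ≠ 0 → ¬ IsValid L M (c - Matrix.mulVec L z)

/-- A single legal firing: one site is fired and the result is valid. -/
def LegalStep (c d : Fin n → ℤ) : Prop :=
  ∃ i, d = fire L c i ∧ IsValid L M d

/-- `c` is valid and is obtained by a finite, possibly empty, sequence of legal firings from a
valid configuration at which every site is ready to fire. -/
def IsReachable (c : Fin n → ℤ) : Prop :=
  IsValid L M c ∧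
    ∃ d, IsValid L M d ∧ (∀ i, IsValid L M (fire L d i)) ∧
      Relation.ReflTransGen (LegalStep L M) d c

def IsCritical (c : Fin n → ℤ) : Prop :=
  IsStable L M c ∧ IsReachable L M c

end ChipFiring

namespace SignedGraph

variable {n : ℕ} (S : SignedGraph (Fin (n + 1)))

/-- Critical configurations of a signed graph, for the chip-firing pair formed by its reduced
signed Laplacian and the reduced Laplacian of the underlying unsigned graph. -/
def IsCritical (c : Fin n → ℤ) : Prop :=
  ChipFiring.IsCritical S.reducedLaplacian (allPositive S.graph).reducedLaplacian c

/-- `z`-superstable configurations of a signed graph, for the same chip-firing pair. -/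
def IsZSuperstable (c : Fin n → ℤ) : Prop :=
  ChipFiring.IsZSuperstable S.reducedLaplacian (allPositive S.graph).reducedLaplacian c

/-- `e` is a critical configuration that represents the identity of the critical group. -/
def IsIdentity (e : Fin n → ℤ) : Prop :=
  S.IsCritical e ∧ (Submodule.Quotient.mk e : S.CriticalGroup) = 0

/-- The negative cycle `-C_{n+1}` on `n + 1` vertices, with the last vertex as sink. -/
noncomputable def negativeCycle (n : ℕ) : SignedGraph (Fin (n + 1)) :=
  negative (SimpleGraph.cycleGraph (n + 1)) (Fin.last n)

end SignedGraph

/-!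
Write `N = n + 1` for the length of the cycle, `n` even, and encode a configuration `c` by the real
vector `x = M L⁻¹ c`. Then `c` is valid exactly when `x ≥ 0`, and firing a multiset `z` replaces `x`
by `x - M z`. Hence the fractional part of `x` never changes, and the dynamics of `c` is the ordinary
chip-firing of the all-positive cycle on the integer vector `⌊x⌋` (`floorCoords`).

The special feature of odd cycles is that `⌊x⌋` always lies in the image of `M`
(`exists_floorCoords_eq_pathMatrix_mulVec`). An integer vector `y` lies in this image when `N` divides
`∑ k y_k`. If `L z = c`, then `x = 4 z - c` because `L + M = 4`. Modulo `1` one has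
`z_k = ± k z_1` with alternating signs, and `N z_1 = 0`; as `N` is odd, `z_(N-k)` and `z_k` differ by an
integer. Pairing `k` with `N - k`, and summing `c_k = z_(k-1) + 2 z_k + z_(k+1)` by parts, gives
`2 ∑ k ⌊x_k⌋ = 0` modulo `N`.

Among the integer vectors in the image of `M`, the only superstable one is `0`
(`isZSuperstable_iff_floorCoords_eq_zero`), and the only critical one is the all-ones vector
(`isCritical_iff_floorCoords_eq_one`); the latter lies in the image because `1 + ⋯ + n` is divisible
by `N`. The first fact needs only that `M` is inverse-positive; the second also uses the burning
condition satisfied by reachable vectors and the termination of firing. So superstable and critical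
configurations are those with `⌊x⌋ = 0` and `⌊x⌋ = 1`, and they differ by the translation by `L w`
with `M w = 1`, which is also the only critical configuration in the image of `L`.
-/

namespace ChipFiring

variable {n : ℕ} (L M : Matrix (Fin n) (Fin n) ℤ)

/-! ### Integral coordinates of a configuration -/

/-- The coordinatewise floor of `M L⁻¹ c`. Firing a multiset `z` of sites changes `M L⁻¹ c` by the
integer vector `M z`, so only this integral part matters for the dynamics. -/
noncomputable def floorCoords (c : Fin n → ℤ) : Fin n → ℤ := fun i =>
  ⌊Matrix.mulVec (M.map (Int.cast : ℤ → ℝ) * (L.map (Int.cast : ℤ → ℝ))⁻¹) (fun j => (c j : ℝ)) i⌋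

theorem map_intCast_mulVec (A : Matrix (Fin n) (Fin n) ℤ) (z : Fin n → ℤ) :
    Matrix.mulVec (A.map (Int.cast : ℤ → ℝ)) (fun j => (z j : ℝ)) =
      fun i => ((Matrix.mulVec A z i : ℤ) : ℝ) := by
  ext i
  simp [Matrix.mulVec, dotProduct]

variable {L M}

theorem isValid_iff_floorCoords_nonneg (hL : IsUnit (L.map (Int.cast : ℤ → ℝ)).det)
    (hM : IsUnit (M.map (Int.cast : ℤ → ℝ)).det) (c : Fin n → ℤ) :
    IsValid L M c ↔ ∀ i, 0 ≤ floorCoords L M c i := by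
  constructor
  · rintro ⟨x, hx, hc⟩ i
    rw [floorCoords, Int.floor_nonneg, hc, Matrix.mulVec_mulVec, Matrix.mul_assoc,
      Matrix.nonsing_inv_mul_cancel_left _ _ hL, Matrix.mul_nonsing_inv _ hM, Matrix.one_mulVec]
    exact hx i
  · intro h
    refine ⟨_, fun i => Int.floor_nonneg.1 (h i), ?_⟩
    rw [Matrix.mulVec_mulVec, Matrix.mul_assoc, Matrix.nonsing_inv_mul_cancel_left _ _ hM,
      Matrix.mul_nonsing_inv _ hL, Matrix.one_mulVec]

theorem floorCoords_sub_mulVec (hL : IsUnit (L.map (Int.cast : ℤ → ℝ)).det) (c z : Fin n → ℤ) :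
    floorCoords L M (c - Matrix.mulVec L z) = floorCoords L M c - Matrix.mulVec M z := by
  have hcast : (fun j => (((c - Matrix.mulVec L z) j : ℤ) : ℝ)) =
      (fun j => (c j : ℝ)) - Matrix.mulVec (L.map (Int.cast : ℤ → ℝ)) (fun j => (z j : ℝ)) := by
    rw [map_intCast_mulVec]
    ext j
    simp
  ext i
  rw [floorCoords, hcast, Matrix.mulVec_sub, Matrix.mulVec_mulVec,
    Matrix.nonsing_inv_mul_cancel_right _ _ hL, map_intCast_mulVec, Pi.sub_apply,
    Int.floor_sub_intCast]
  rfl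

theorem floorCoords_add_mulVec (hL : IsUnit (L.map (Int.cast : ℤ → ℝ)).det) (c z : Fin n → ℤ) :
    floorCoords L M (c + Matrix.mulVec L z) = floorCoords L M c + Matrix.mulVec M z := by
  have h := floorCoords_sub_mulVec (M := M) hL c (-z)
  simpa only [Matrix.mulVec_neg, sub_neg_eq_add] using h

theorem floorCoords_zero : floorCoords L M 0 = 0 := by
  ext i
  have : (fun j : Fin n => (((0 : Fin n → ℤ) j : ℤ) : ℝ)) = 0 := by ext; simp
  rw [floorCoords, this, Matrix.mulVec_zero]
  simp

/-! ### Recurrence and stabilization -/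

/-- The burning condition: every nonempty set `F` of sites contains a site `v` holding at least as
many chips as it would receive if each other site of `F` fired once. -/
def NoForbiddenSubset (M : Matrix (Fin n) (Fin n) ℤ) (y : Fin n → ℤ) : Prop :=
  ∀ F : Finset (Fin n), F.Nonempty → ∃ v ∈ F, ∑ u ∈ F.erase v, -M v u ≤ y v

theorem NoForbiddenSubset.sub_mulVec_single (hoff : ∀ i j, i ≠ j → M i j ≤ 0) {y : Fin n → ℤ}
    (hy : NoForbiddenSubset M y) (i : Fin n)
    (hpos : ∀ j, 0 ≤ (y - Matrix.mulVec M (Pi.single i 1)) j) :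
    NoForbiddenSubset M (y - Matrix.mulVec M (Pi.single i 1)) := by
  have hval : ∀ j, (y - Matrix.mulVec M (Pi.single i 1)) j = y j - M j i := fun j => by simp
  intro F hF
  by_cases hi : i ∈ F
  · rcases (F.erase i).eq_empty_or_nonempty with he | hne
    · exact ⟨i, hi, by rw [he, Finset.sum_empty]; exact hpos i⟩
    · obtain ⟨v, hv, hle⟩ := hy _ hne
      have hvi := Finset.ne_of_mem_erase hv
      refine ⟨v, Finset.mem_of_mem_erase hv, ?_⟩
      have hmem : i ∈ F.erase v := Finset.mem_erase.2 ⟨hvi.symm, hi⟩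
      rw [← Finset.add_sum_erase _ _ hmem, Finset.erase_right_comm, hval]
      linarith
  · obtain ⟨v, hv, hle⟩ := hy F hF
    have hvi : v ≠ i := fun h => hi (h ▸ hv)
    refine ⟨v, hv, ?_⟩
    rw [hval]
    linarith [hoff v i hvi]

/-- A vector satisfying the burning condition cannot be the result of firing a nonempty multiset
`v` of sites from a stable vector: the burning condition on the set where `v` is largest produces
a site of `y + M v` that is ready to fire. -/
theorem NoForbiddenSubset.exists_diag_le_add_mulVec (hoff : ∀ i j, i ≠ j → M i j ≤ 0)
    (hrow : ∀ i, 0 ≤ ∑ j, M i j) {y : Fin n → ℤ} (hy : NoForbiddenSubset M y) {v : Fin n → ℤ}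
    (hv : ∀ i, 0 ≤ v i) (hv0 : v ≠ 0) : ∃ k, M k k ≤ (y + Matrix.mulVec M v) k := by
  classical
  obtain ⟨i₀, hi₀⟩ := Function.ne_iff.1 hv0
  obtain ⟨a, -, ha⟩ := Finset.exists_max_image Finset.univ v ⟨i₀, Finset.mem_univ _⟩
  have hi₀' : v i₀ ≠ 0 := hi₀
  have h1 : 1 ≤ v a := by
    have := ha i₀ (Finset.mem_univ _)
    have := hv i₀
    omega
  obtain ⟨k, hk, hle⟩ := hy (Finset.univ.filter fun j => v j = v a) ⟨a, by simp⟩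
  refine ⟨k, ?_⟩
  have hka : v k = v a := (Finset.mem_filter.1 hk).2
  set F := Finset.univ.filter fun j => v j = v a
  have hsum : ∑ j, (M k j * (v a - 1) + if j ∈ F then M k j else 0) ≤ ∑ j, M k j * v j := by
    refine Finset.sum_le_sum fun j _ => ?_
    by_cases hj : j ∈ F
    · have : v j = v a := (Finset.mem_filter.1 hj).2
      rw [if_pos hj, this]
      linarith
    · have hne : v j ≠ v a := fun h => hj (by simp [F, h])
      have hjk : k ≠ j := fun h => hne (h ▸ hka)
      have := ha j (Finset.mem_univ _)
      have hlt : v j ≤ v a - 1 := by omega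
      rw [if_neg hj, add_zero]
      exact mul_le_mul_of_nonpos_left hlt (hoff k j hjk)
  rw [Finset.sum_add_distrib, ← Finset.sum_mul, Finset.sum_ite_mem, Finset.univ_inter,
    ← Finset.add_sum_erase _ _ hk] at hsum
  rw [Finset.sum_neg_distrib] at hle
  have hr := mul_nonneg (hrow k) (sub_nonneg.2 h1)
  have : Matrix.mulVec M v k = ∑ j, M k j * v j := rfl
  rw [Pi.add_apply, this]
  linarith

theorem noForbiddenSubset_of_diag_le (hrow : ∀ i, 0 ≤ ∑ j, M i j) (hoff : ∀ i j, i ≠ j → M i j ≤ 0)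
    {y : Fin n → ℤ} (hy : ∀ i, M i i ≤ y i) : NoForbiddenSubset M y := by
  rintro F ⟨v, hv⟩
  refine ⟨v, hv, ?_⟩
  have h1 : ∑ u ∈ F.erase v, -M v u ≤ ∑ u ∈ Finset.univ.erase v, -M v u :=
    Finset.sum_le_sum_of_subset_of_nonneg (Finset.erase_subset_erase _ (Finset.subset_univ _))
      fun u hu _ => neg_nonneg.2 (hoff v u (Finset.ne_of_mem_erase hu).symm)
  have h2 := Finset.add_sum_erase Finset.univ (fun u => M v u) (Finset.mem_univ v)
  rw [Finset.sum_neg_distrib (s := Finset.univ.erase v)] at h1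
  linarith [hrow v, hy v]

theorem exists_eq_sub_mulVec_of_reflTransGen {c d : Fin n → ℤ}
    (h : Relation.ReflTransGen (LegalStep L M) c d) : ∃ z, d = c - Matrix.mulVec L z := by
  induction h with
  | refl => exact ⟨0, by simp⟩
  | tail _ hstep ih =>
    obtain ⟨z, rfl⟩ := ih
    obtain ⟨i, rfl, -⟩ := hstep
    exact ⟨z + Pi.single i 1, by rw [fire, Matrix.mulVec_add, sub_sub]⟩

theorem floorCoords_fire (hL : IsUnit (L.map (Int.cast : ℤ → ℝ)).det) (c : Fin n → ℤ) (i : Fin n) :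
    floorCoords L M (fire L c i) = floorCoords L M c - Matrix.mulVec M (Pi.single i 1) :=
  floorCoords_sub_mulVec hL c _

/-- Firing terminates when `M` is inverse-positive and the integral part of `c` is `M u`: then
`u ≥ 0`, and each firing lowers the sum of `u` by one. -/
theorem exists_isStable_reflTransGen (hL : IsUnit (L.map (Int.cast : ℤ → ℝ)).det)
    (hM : IsUnit (M.map (Int.cast : ℤ → ℝ)).det)
    (hpos : ∀ u : Fin n → ℤ, (∀ i, 0 ≤ Matrix.mulVec M u i) → ∀ i, 0 ≤ u i)
    {c : Fin n → ℤ} (hc : IsValid L M c) {u : Fin n → ℤ}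
    (hu : floorCoords L M c = Matrix.mulVec M u) :
    ∃ d, Relation.ReflTransGen (LegalStep L M) c d ∧ IsStable L M d := by
  obtain ⟨N, hN⟩ : ∃ N : ℕ, ∑ i, u i ≤ N := ⟨(∑ i, u i).toNat, Int.self_le_toNat _⟩
  induction N generalizing c u with
  | zero =>
    refine ⟨c, .refl, hc, fun i hi => ?_⟩
    rw [isValid_iff_floorCoords_nonneg hL hM, floorCoords_fire hL, hu, ← Matrix.mulVec_sub] at hi
    have h := Finset.sum_nonneg fun j (_ : j ∈ Finset.univ) => hpos _ hi j
    simp only [Pi.sub_apply, Finset.sum_sub_distrib, Finset.sum_pi_single', Finset.mem_univ,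
      if_true] at h
    push_cast at hN
    linarith
  | succ N ih =>
    by_cases hs : IsStable L M c
    · exact ⟨c, .refl, hs⟩
    · obtain ⟨i, hi⟩ : ∃ i, IsValid L M (fire L c i) := by
        by_contra! h
        exact hs ⟨hc, h⟩
      have hu' : floorCoords L M (fire L c i) = Matrix.mulVec M (u - Pi.single i 1) := by
        rw [floorCoords_fire hL, hu, Matrix.mulVec_sub]
      obtain ⟨d, hd, hds⟩ := ih hi hu' (by
        simp only [Pi.sub_apply, Finset.sum_sub_distrib, Finset.sum_pi_single', Finset.mem_univ,
          if_true]
        push_cast at hN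
        linarith)
      exact ⟨d, .head ⟨i, rfl, hi⟩ hd, hds⟩

/-! ### Superstable and critical configurations with integral part in the image of `M` -/

theorem mulVec_injective_of_inversePositive
    (hpos : ∀ u : Fin n → ℤ, (∀ i, 0 ≤ Matrix.mulVec M u i) → ∀ i, 0 ≤ u i) :
    Function.Injective (Matrix.mulVec M) := by
  intro u v huv
  have h1 := hpos (u - v) fun i => by rw [Matrix.mulVec_sub, huv, sub_self]; rfl
  have h2 := hpos (v - u) fun i => by rw [Matrix.mulVec_sub, huv, sub_self]; rfl
  ext i
  have := h1 i
  have := h2 i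
  simp only [Pi.sub_apply] at *
  omega

/-- If `c` is `z`-superstable with integral part `M u`, then `u ≥ 0` by inverse positivity, and firing
`u` leaves a configuration with integral part `0`; hence `u = 0`. -/
theorem isZSuperstable_iff_floorCoords_eq_zero (hL : IsUnit (L.map (Int.cast : ℤ → ℝ)).det)
    (hM : IsUnit (M.map (Int.cast : ℤ → ℝ)).det)
    (hpos : ∀ u : Fin n → ℤ, (∀ i, 0 ≤ Matrix.mulVec M u i) → ∀ i, 0 ≤ u i)
    (hrange : ∀ c, ∃ u, floorCoords L M c = Matrix.mulVec M u) (c : Fin n → ℤ) :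
    IsZSuperstable L M c ↔ floorCoords L M c = 0 := by
  simp only [IsZSuperstable, isValid_iff_floorCoords_nonneg hL hM, floorCoords_sub_mulVec hL]
  constructor
  · rintro ⟨hc, hz⟩
    obtain ⟨u, hu⟩ := hrange c
    rw [hu] at hc hz ⊢
    by_cases h0 : u = 0
    · rw [h0, Matrix.mulVec_zero]
    · exact absurd (fun i => by simp) (hz u (hpos u hc) h0)
  · intro h
    refine ⟨fun i => by rw [h]; rfl, fun z hz hz0 hv => hz0 ?_⟩
    have h' := hpos (-z) fun i => by simpa [h, Matrix.mulVec_neg] using hv i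
    funext i
    have h1 := h' i
    rw [Pi.neg_apply, neg_nonneg] at h1
    exact le_antisymm h1 (hz i)

theorem IsReachable.noForbiddenSubset (hL : IsUnit (L.map (Int.cast : ℤ → ℝ)).det)
    (hM : IsUnit (M.map (Int.cast : ℤ → ℝ)).det) (hoff : ∀ i j, i ≠ j → M i j ≤ 0)
    (hrow : ∀ i, 0 ≤ ∑ j, M i j) {c : Fin n → ℤ} (hc : IsReachable L M c) :
    NoForbiddenSubset M (floorCoords L M c) := by
  obtain ⟨-, d, -, hfire, hdc⟩ := hc
  induction hdc with
  | refl =>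
    refine noForbiddenSubset_of_diag_le hrow hoff fun i => ?_
    have h := (isValid_iff_floorCoords_nonneg hL hM _).1 (hfire i) i
    rw [floorCoords_fire hL] at h
    simpa using h
  | tail _ hstep ih =>
    obtain ⟨i, rfl, hv⟩ := hstep
    rw [isValid_iff_floorCoords_nonneg hL hM, floorCoords_fire hL] at hv
    rw [floorCoords_fire hL]
    exact ih.sub_mulVec_single hoff i hv

/-- A stable configuration has integral part `M u ≤ 1 = M w`, so `w - u ≥ 0`, and the burning
condition forces `w = u`. Conversely, a configuration with integral part `1` is reached by
stabilizing its translate by `L w`. -/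
theorem isCritical_iff_floorCoords_eq_one (hL : IsUnit (L.map (Int.cast : ℤ → ℝ)).det)
    (hM : IsUnit (M.map (Int.cast : ℤ → ℝ)).det)
    (hpos : ∀ u : Fin n → ℤ, (∀ i, 0 ≤ Matrix.mulVec M u i) → ∀ i, 0 ≤ u i)
    (hrange : ∀ c, ∃ u, floorCoords L M c = Matrix.mulVec M u)
    (hdiag : ∀ i, M i i = 2) (hoff : ∀ i j, i ≠ j → M i j ≤ 0) (hrow : ∀ i, 0 ≤ ∑ j, M i j)
    {w : Fin n → ℤ} (hw : Matrix.mulVec M w = 1) (c : Fin n → ℤ) :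
    IsCritical L M c ↔ floorCoords L M c = 1 := by
  have hvalid := isValid_iff_floorCoords_nonneg (L := L) (M := M) hL hM
  have hle : ∀ i j, M j i ≤ 2 := fun i j => by
    rcases eq_or_ne j i with rfl | h
    · exact (hdiag j).le
    · exact (hoff j i h).trans (by norm_num)
  have key : ∀ c, IsCritical L M c → floorCoords L M c = 1 := by
    rintro c ⟨⟨hc, hst⟩, hr⟩
    obtain ⟨u, hu⟩ := hrange c
    have hle1 : ∀ i, floorCoords L M c i ≤ 1 := fun i => by
      by_contra! h
      refine hst i ((hvalid _).2 fun j => ?_)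
      rw [floorCoords_fire hL]
      have hcj := (hvalid c).1 hc j
      rcases eq_or_ne j i with rfl | hji
      · simpa [hdiag] using (show 2 ≤ floorCoords L M c j by omega)
      · have := hoff j i hji
        simp only [Pi.sub_apply, Matrix.mulVec_single_one, Matrix.col_apply]
        omega
    have hsum : floorCoords L M c + Matrix.mulVec M (w - u) = 1 := by
      rw [Matrix.mulVec_sub, hw, hu]
      abel
    have hwu := hpos (w - u) fun i => by
      have h1 := congrFun hsum i
      have h2 := hle1 i
      simp only [Pi.add_apply, Pi.one_apply] at h1
      omega
    by_cases h0 : w - u = 0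
    · rwa [h0, Matrix.mulVec_zero, add_zero] at hsum
    · obtain ⟨k, hk⟩ := (hr.noForbiddenSubset hL hM hoff hrow).exists_diag_le_add_mulVec
        hoff hrow hwu h0
      rw [hsum, hdiag] at hk
      norm_num at hk
  refine ⟨key c, fun h => ?_⟩
  have hc : IsValid L M c := (hvalid c).2 fun i => by rw [h]; exact zero_le_one
  -- Adding `L w` raises every integral coordinate to `2`, so that all sites become ready to fire;
  -- stabilizing leads to a critical configuration in the class of `c`, which must be `c` itself.
  have hd : ∀ i, floorCoords L M (c + Matrix.mulVec L w) i = 2 := fun i => by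
    rw [floorCoords_add_mulVec hL, h, hw]
    rfl
  have hdv : IsValid L M (c + Matrix.mulVec L w) := (hvalid _).2 fun i => by rw [hd]; norm_num
  have hdf : ∀ i, IsValid L M (fire L (c + Matrix.mulVec L w) i) := fun i =>
    (hvalid _).2 fun j => by
      rw [floorCoords_fire hL, Pi.sub_apply, hd]
      simpa using hle i j
  obtain ⟨u, hu⟩ := hrange (c + Matrix.mulVec L w)
  obtain ⟨c', hpath, hst⟩ := exists_isStable_reflTransGen hL hM hpos hdv hu
  have hcrit : IsCritical L M c' := ⟨hst, hst.1, _, hdv, hdf, hpath⟩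
  obtain ⟨z, hz⟩ := exists_eq_sub_mulVec_of_reflTransGen hpath
  have h1 := key c' hcrit
  rw [hz, floorCoords_sub_mulVec hL, floorCoords_add_mulVec hL, h, hw, sub_eq_iff_eq_add,
    add_right_inj] at h1
  have hzw : w = z := mulVec_injective_of_inversePositive hpos (hw.trans h1)
  rw [hzw, add_sub_cancel_right] at hz
  rwa [← hz]

/-- If the integral part of every configuration lies in the image of `M`, the critical
configurations are the translates of the `z`-superstable ones by `L w`, where `M w = 1`, and
`L w` is the only critical configuration in the image of `L`. -/
theorem existsUnique_and_bijOn (hL : IsUnit (L.map (Int.cast : ℤ → ℝ)).det)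
    (hM : IsUnit (M.map (Int.cast : ℤ → ℝ)).det)
    (hpos : ∀ u : Fin n → ℤ, (∀ i, 0 ≤ Matrix.mulVec M u i) → ∀ i, 0 ≤ u i)
    (hrange : ∀ c, ∃ u, floorCoords L M c = Matrix.mulVec M u)
    (hdiag : ∀ i, M i i = 2) (hoff : ∀ i j, i ≠ j → M i j ≤ 0) (hrow : ∀ i, 0 ≤ ∑ j, M i j)
    {w : Fin n → ℤ} (hw : Matrix.mulVec M w = 1) :
    (∃! e, IsCritical L M e ∧ e ∈ LinearMap.range L.mulVecLin) ∧
      ∀ e, (IsCritical L M e ∧ e ∈ LinearMap.range L.mulVecLin) →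
        Set.BijOn (fun c => e + c) {c | IsZSuperstable L M c} {c | IsCritical L M c} := by
  have hcrit := isCritical_iff_floorCoords_eq_one hL hM hpos hrange hdiag hoff hrow hw
  have hadd : ∀ c, floorCoords L M (Matrix.mulVec L w + c) = floorCoords L M c + 1 := fun c => by
    rw [add_comm, floorCoords_add_mulVec hL, hw]
  have huniq : ∀ e, (IsCritical L M e ∧ e ∈ LinearMap.range L.mulVecLin) →
      e = Matrix.mulVec L w := by
    rintro _ ⟨he, u, rfl⟩
    rw [hcrit, Matrix.mulVecLin_apply, ← zero_add (Matrix.mulVec L u), floorCoords_add_mulVec hL,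
      floorCoords_zero, zero_add, ← hw] at he
    rw [mulVec_injective_of_inversePositive hpos he, Matrix.mulVecLin_apply]
  refine ⟨⟨Matrix.mulVec L w, ⟨?_, w, rfl⟩, huniq⟩, fun e he => ?_⟩
  · rw [hcrit, ← add_zero (Matrix.mulVec L w), hadd, floorCoords_zero, zero_add]
  · rw [huniq e he]
    simp only [hcrit, isZSuperstable_iff_floorCoords_eq_zero hL hM hpos hrange]
    refine ⟨fun c hc => ?_, (add_right_injective _).injOn, fun c hc => ?_⟩
    · have hc0 : floorCoords L M c = 0 := hc
      exact (hadd c).trans (by rw [hc0, zero_add])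
    · have hc1 : floorCoords L M c = 1 := hc
      exact ⟨c - Matrix.mulVec L w,
        (floorCoords_sub_mulVec hL c w).trans (by rw [hw, hc1, sub_self]), add_sub_cancel _ _⟩

end ChipFiring

/-! ### Tridiagonal matrices of a path -/

section Path

variable {R : Type*} {n : ℕ}

/-- The `n × n` tridiagonal matrix with diagonal `2` and with `s` next to the diagonal. -/
def pathMatrix [CommRing R] (n : ℕ) (s : R) : Matrix (Fin n) (Fin n) R :=
  Matrix.of fun i j => if i = j then 2 else if (i : ℕ) + 1 = j ∨ (j : ℕ) + 1 = i then s else 0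

/-- A vector on the sites `1, …, n` of a path, extended by zero to all natural numbers; the entry
with index `i : Fin n` sits at the site `i + 1`. -/
def padZero [CommRing R] (u : Fin n → R) (k : ℕ) : R :=
  ∑ j : Fin n, if (j : ℕ) + 1 = k then u j else 0

variable [CommRing R]

theorem padZero_succ (u : Fin n → R) (i : Fin n) : padZero u (i + 1) = u i := by
  simp [padZero, Fin.val_inj]

theorem padZero_zero (u : Fin n → R) : padZero u 0 = 0 := by simp [padZero]

theorem padZero_last (u : Fin n → R) : padZero u (n + 1) = 0 := by
  refine Finset.sum_eq_zero fun j _ => if_neg ?_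
  have := j.isLt
  omega

theorem pathMatrix_mulVec (s : R) (u : Fin n → R) (i : Fin n) :
    Matrix.mulVec (pathMatrix n s) u i =
      2 * padZero u (i + 1) + s * (padZero u i + padZero u (i + 2)) := by
  rw [padZero_succ]
  have h2 : 2 * u i = ∑ j, if i = j then 2 * u j else 0 := by simp
  simp only [h2, padZero, ← Finset.sum_add_distrib, Finset.mul_sum, Matrix.mulVec, dotProduct]
  refine Finset.sum_congr rfl fun j _ => ?_
  simp only [pathMatrix, Matrix.of_apply, Fin.ext_iff]
  split_ifs <;> first | omega | ring

theorem pathMatrix_map_intCast (n : ℕ) (s : ℤ) :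
    (pathMatrix n s).map (Int.cast : ℤ → ℝ) = pathMatrix n (s : ℝ) := by
  ext i j
  simp only [pathMatrix, Matrix.map_apply, Matrix.of_apply]
  split_ifs <;> simp

theorem eq_zero_of_padZero_eq_zero {u : Fin n → R} (h : ∀ k ≤ n + 1, padZero u k = 0) :
    u = 0 := by
  ext i
  rw [← padZero_succ u i, h _ (by omega)]
  rfl

/-- A sequence that vanishes at both ends and has nonpositive second differences is nonnegative:
once negative it would have to keep decreasing. -/
theorem nonneg_of_second_difference [LinearOrder R] [IsStrictOrderedRing R] {f : ℕ → R}
    (h0 : f 0 = 0) (hn : f (n + 1) = 0) (hf : ∀ i < n, f i + f (i + 2) ≤ 2 * f (i + 1))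
    {k : ℕ} (hk : k ≤ n + 1) : 0 ≤ f k := by
  induction k with
  | zero => exact h0.ge
  | succ k ih =>
    by_contra! hneg
    have hdec : ∀ j, k + 1 + j ≤ n + 1 → f (k + 1 + j) < 0 ∧ f (k + 1 + j) ≤ f (k + j) := by
      intro j
      induction j with
      | zero => exact fun _ => ⟨hneg, (hneg.trans_le (ih (by omega))).le⟩
      | succ j ihj =>
        intro hj
        obtain ⟨h1, h2⟩ := ihj (by omega)
        have h3 := hf (k + j) (by omega)
        rw [show k + 1 + j = k + j + 1 by omega] at h1 h2
        rw [show k + 1 + (j + 1) = k + j + 2 by omega, show k + (j + 1) = k + j + 1 by omega]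
        constructor <;> linarith
    have := (hdec (n - k) (by omega)).1
    rw [show k + 1 + (n - k) = n + 1 by omega, hn] at this
    exact this.false

theorem pathMatrix_inversePositive [LinearOrder R] [IsStrictOrderedRing R] (u : Fin n → R)
    (hu : ∀ i, 0 ≤ Matrix.mulVec (pathMatrix n (-1 : R)) u i) (i : Fin n) : 0 ≤ u i := by
  rw [← padZero_succ u i]
  refine nonneg_of_second_difference (padZero_zero u) (padZero_last u) (fun j hj => ?_)
    (by omega)
  have h := hu ⟨j, hj⟩
  rw [pathMatrix_mulVec] at h
  linarith

theorem pathMatrix_neg_one_det_isUnit (n : ℕ) : IsUnit (pathMatrix n (-1 : ℝ)).det := by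
  rw [isUnit_iff_ne_zero, Ne, ← Matrix.exists_mulVec_eq_zero_iff]
  rintro ⟨u, hu0, hu⟩
  refine hu0 (funext fun i => le_antisymm ?_ ?_)
  · have := pathMatrix_inversePositive (-u) (fun j => by simp [Matrix.mulVec_neg, hu]) i
    simpa using this
  · exact pathMatrix_inversePositive u (fun j => by simp [hu]) i

/-- Modulo an additive subgroup containing all the sums `f i + 2 f (i + 1) + f (i + 2)`, a sequence
starting at zero is `f k = (-1) ^ (k + 1) k f 1`. -/
theorem alternating_linear_mem (A : AddSubgroup R) {f : ℕ → R} (h0 : f 0 = 0)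
    (hf : ∀ i < n, f i + 2 * f (i + 1) + f (i + 2) ∈ A) {k : ℕ} (hk : k ≤ n + 1) :
    f k + (-1) ^ k * k * f 1 ∈ A := by
  induction k using Nat.strong_induction_on with
  | _ k ih =>
    match k with
    | 0 => simp [h0]
    | 1 => simp
    | k + 2 =>
      have h1 := ih k (by omega) (by omega)
      have h2 := ih (k + 1) (by omega) (by omega)
      have h3 := A.sub_mem (A.sub_mem (A.sub_mem (hf k (by omega)) h1) h2) h2
      convert h3 using 1
      push_cast
      ring

theorem pathMatrix_one_det_isUnit (n : ℕ) : IsUnit (pathMatrix n (1 : ℝ)).det := by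
  rw [isUnit_iff_ne_zero, Ne, ← Matrix.exists_mulVec_eq_zero_iff]
  rintro ⟨u, hu0, hu⟩
  have hf : ∀ i < n, padZero u i + 2 * padZero u (i + 1) + padZero u (i + 2) ∈
      (⊥ : AddSubgroup ℝ) := fun i hi => by
    have h := congrFun hu ⟨i, hi⟩
    rw [pathMatrix_mulVec, Pi.zero_apply] at h
    rw [AddSubgroup.mem_bot]
    linarith
  have hlin : ∀ k ≤ n + 1, padZero u k + (-1) ^ k * k * padZero u 1 = 0 := fun k hk =>
    AddSubgroup.mem_bot.1 (alternating_linear_mem ⊥ (padZero_zero u) hf hk)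
  have h1 : padZero u 1 = 0 := by
    have h := hlin (n + 1) le_rfl
    rw [padZero_last, zero_add] at h
    have hne : (-1 : ℝ) ^ (n + 1) * ((n + 1 : ℕ) : ℝ) ≠ 0 :=
      mul_ne_zero (pow_ne_zero _ (by norm_num)) (Nat.cast_ne_zero.2 n.succ_ne_zero)
    exact (mul_eq_zero.1 h).resolve_left hne
  refine hu0 (eq_zero_of_padZero_eq_zero fun k hk => ?_)
  have h := hlin k hk
  rwa [h1, mul_zero, add_zero] at h

theorem sum_pathMatrix_neg_one_nonneg (i : Fin n) : 0 ≤ ∑ j, pathMatrix n (-1 : ℤ) i j := by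
  have h := pathMatrix_mulVec (-1 : ℤ) (fun _ => 1) i
  have hle : ∀ k, padZero (fun _ : Fin n => (1 : ℤ)) k ≤ 1 := fun k => by
    by_cases hk : ∃ j : Fin n, (j : ℕ) + 1 = k
    · obtain ⟨j, rfl⟩ := hk
      rw [padZero_succ]
    · rw [padZero, Finset.sum_eq_zero fun j _ => if_neg fun h => hk ⟨j, h⟩]
      exact zero_le_one
  have h1 := hle i
  have h2 := hle (i + 2)
  rw [padZero_succ] at h
  simp only [Matrix.mulVec, dotProduct, mul_one] at h
  rw [h]
  linarith

/-! ### Integral parts and the image of the path Laplacian -/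

/-- The image of the reduced Laplacian of the cycle on `n + 1` vertices contains the vectors whose
weighted sum `∑ i yᵢ` over the sites `i = 1, …, n` is divisible by `n + 1`. -/
theorem exists_pathMatrix_mulVec_eq {y : Fin n → ℤ}
    (hy : (n + 1 : ℤ) ∣ ∑ i : Fin n, ((i : ℕ) + 1 : ℤ) * y i) :
    ∃ u, y = Matrix.mulVec (pathMatrix n (-1 : ℤ)) u := by
  obtain ⟨t, ht⟩ : (n + 1 : ℤ) ∣ ∑ i : Fin n, ((n : ℤ) - (i : ℕ)) * y i := by
    have : ∑ i : Fin n, ((n : ℤ) - (i : ℕ)) * y i =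
        (n + 1) * ∑ i, y i - ∑ i : Fin n, ((i : ℕ) + 1 : ℤ) * y i := by
      rw [Finset.mul_sum, ← Finset.sum_sub_distrib]
      exact Finset.sum_congr rfl fun i _ => by ring
    rw [this]
    exact dvd_sub (dvd_mul_right _ _) hy
  -- The solution of the recurrence with `U 0 = 0` and slope `t` at the start.
  let U : ℕ → ℤ := fun k => k * t - ∑ j : Fin n, ((k - ((j : ℕ) + 1) : ℕ) : ℤ) * y j
  have hpad : ∀ k ≤ n + 1, padZero (fun i : Fin n => U (i + 1)) k = U k := by
    intro k hk
    rcases Nat.eq_zero_or_pos k with rfl | hk0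
    · simp [padZero_zero, U]
    rcases hk.eq_or_lt with rfl | hlt
    · rw [padZero_last]
      have : ∑ j : Fin n, ((n + 1 - ((j : ℕ) + 1) : ℕ) : ℤ) * y j =
          ∑ i : Fin n, ((n : ℤ) - (i : ℕ)) * y i := by
        refine Finset.sum_congr rfl fun j _ => ?_
        have := j.isLt
        congr 1
        omega
      simp only [U, this, ht]
      push_cast
      ring
    · obtain ⟨k, rfl⟩ := Nat.exists_eq_succ_of_ne_zero hk0.ne'
      exact padZero_succ (fun i : Fin n => U (i + 1)) ⟨k, by omega⟩
  refine ⟨fun i => U (i + 1), funext fun i => ?_⟩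
  have hi := i.isLt
  rw [pathMatrix_mulVec, hpad _ (by omega), hpad _ (by omega), hpad _ (by omega)]
  have hyi : y i = ∑ j, if i = j then y j else 0 := by simp
  have hsum : y i = ∑ j : Fin n, ((((i : ℕ) - ((j : ℕ) + 1) : ℕ) : ℤ) * y j +
      (((i : ℕ) + 2 - ((j : ℕ) + 1) : ℕ) : ℤ) * y j -
      2 * ((((i : ℕ) + 1 - ((j : ℕ) + 1) : ℕ) : ℤ) * y j)) := by
    conv_lhs => rw [hyi]
    refine Finset.sum_congr rfl fun j _ => ?_
    have : (((i : ℕ) - ((j : ℕ) + 1) : ℕ) : ℤ) + (((i : ℕ) + 2 - ((j : ℕ) + 1) : ℕ) : ℤ) -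
        2 * (((i : ℕ) + 1 - ((j : ℕ) + 1) : ℕ) : ℤ) = if i = j then 1 else 0 := by
      simp only [Fin.ext_iff]
      split_ifs <;> omega
    have h2 : (if i = j then y j else 0) = (if i = j then 1 else 0) * y j := by simp
    rw [h2, ← this]
    ring
  rw [Finset.sum_sub_distrib, Finset.sum_add_distrib, ← Finset.mul_sum] at hsum
  simp only [U, Nat.cast_add, Nat.cast_one, Nat.cast_ofNat]
  linarith

/-- Summation by parts. -/
theorem sum_weighted_second_sum (f : ℕ → R) (n : ℕ) :
    ∑ i ∈ Finset.range n, ((i : R) + 1) * (f i + 2 * f (i + 1) + f (i + 2)) =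
      4 * ∑ i ∈ Finset.range n, ((i : R) + 1) * f (i + 1) + n * f (n + 1) - (n + 1) * f n +
        f 0 := by
  induction n with
  | zero => simp
  | succ n ih =>
    rw [Finset.sum_range_succ, Finset.sum_range_succ, ih]
    push_cast
    ring

theorem sum_second_sum (f : ℕ → R) (n : ℕ) :
    ∑ i ∈ Finset.range n, (f i + 2 * f (i + 1) + f (i + 2)) =
      4 * ∑ i ∈ Finset.range n, f (i + 1) + f (n + 1) - f n + f 0 - f 1 := by
  induction n with
  | zero => simp
  | succ n ih =>
    rw [Finset.sum_range_succ, Finset.sum_range_succ, ih]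
    ring

theorem sum_weighted_comp_rev (a : Fin n → R) :
    ∑ i : Fin n, (((i : ℕ) : R) + 1) * a i.rev =
      (n + 1) * ∑ i, a i - ∑ i : Fin n, (((i : ℕ) : R) + 1) * a i := by
  rw [← Equiv.sum_comp Fin.revPerm, Finset.mul_sum, ← Finset.sum_sub_distrib]
  refine Finset.sum_congr rfl fun i _ => ?_
  have h : ((i.rev : ℕ) : R) + 1 + ((i : ℕ) + 1) = n + 1 := by
    have := Fin.val_rev i
    have := i.isLt
    exact_mod_cast congrArg (Nat.cast : ℕ → R)
      (show ((i.rev : ℕ) + 1 + ((i : ℕ) + 1)) = n + 1 by omega)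
  rw [Fin.revPerm_apply, Fin.rev_rev]
  linear_combination a i * h

/-- Reflecting the path changes the solution of `L z = c` by an integer vector when the cycle has
odd length, because modulo `1` the solution is `±k z₁` at the site `k`, with alternating signs. -/
theorem exists_reflection_eq_add_intCast (hn : Even n) {f : ℕ → ℝ} (h0 : f 0 = 0)
    (hlast : f (n + 1) = 0) (c : ℕ → ℤ)
    (hf : ∀ i < n, f i + 2 * f (i + 1) + f (i + 2) = c i) {k : ℕ} (hk : k ≤ n + 1) :
    ∃ g : ℤ, f (n + 1 - k) = f k + g := by
  have hlin : ∀ j ≤ n + 1, f j + (-1) ^ j * j * f 1 ∈ (Int.castAddHom ℝ).range := fun j hj =>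
    alternating_linear_mem _ h0 (fun i hi => AddMonoidHom.mem_range.2 ⟨c i, (hf i hi).symm⟩) hj
  have hodd : (-1 : ℝ) ^ (n + 1) = -1 := hn.add_one.neg_one_pow
  obtain ⟨N, hN⟩ := hlin (n + 1) le_rfl
  obtain ⟨a, ha⟩ := hlin k hk
  obtain ⟨b, hb⟩ := hlin (n + 1 - k) (by omega)
  rw [hlast, hodd] at hN
  have hpow : (-1 : ℝ) ^ (n + 1 - k) = -(-1) ^ k := by
    have h1 : (-1 : ℝ) ^ (n + 1 - k) * (-1) ^ k = -1 := by
      rw [← pow_add, Nat.sub_add_cancel hk, hodd]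
    have h2 : ((-1 : ℝ) ^ k) * (-1) ^ k = 1 := by rw [← mul_pow]; norm_num
    linear_combination (-1 : ℝ) ^ k * h1 - (-1 : ℝ) ^ (n + 1 - k) * h2
  rw [hpow, Nat.cast_sub hk] at hb
  simp only [Int.coe_castAddHom] at hN ha hb
  refine ⟨b - a - (-1) ^ k * N, ?_⟩
  push_cast at hb hN ⊢
  linear_combination ha - hb + (-1 : ℝ) ^ k * hN

/-- On a cycle of odd length, the integral part of every configuration lies in the image of the
reduced Laplacian. With `L z = c` the integral part is `⌊4 z⌋ - c`; its weighted sum modulo `n + 1`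
is computed by pairing each site `k` with `n + 1 - k`, where the values of `z` differ by an
integer. -/
theorem exists_floorCoords_eq_pathMatrix_mulVec (hn : Even n) (c : Fin n → ℤ) :
    ∃ u, ChipFiring.floorCoords (pathMatrix n 1) (pathMatrix n (-1)) c =
      Matrix.mulVec (pathMatrix n (-1 : ℤ)) u := by
  apply exists_pathMatrix_mulVec_eq
  set z : Fin n → ℝ := Matrix.mulVec (pathMatrix n (1 : ℝ))⁻¹ (fun j => (c j : ℝ)) with hz
  set f := padZero z
  have h0 : f 0 = 0 := padZero_zero z
  have hlast : f (n + 1) = 0 := padZero_last z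
  have hfz : ∀ i : Fin n, f (i + 1) = z i := padZero_succ z
  have hLz : ∀ i : Fin n, f i + 2 * f (i + 1) + f (i + 2) = c i := fun i => by
    have h : Matrix.mulVec (pathMatrix n (1 : ℝ)) z i = c i := by
      rw [hz, Matrix.mulVec_mulVec, Matrix.mul_nonsing_inv _ (pathMatrix_one_det_isUnit n),
        Matrix.one_mulVec]
    rw [pathMatrix_mulVec] at h
    linarith
  -- Since `L + M = 4` and `L z = c`, the vector `M L⁻¹ c` is `4 z - c`.
  have hfloor : ∀ i, ChipFiring.floorCoords (pathMatrix n 1) (pathMatrix n (-1)) c i =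
      ⌊4 * z i⌋ - c i := fun i => by
    rw [ChipFiring.floorCoords, pathMatrix_map_intCast, pathMatrix_map_intCast, Int.cast_one,
      Int.cast_neg, Int.cast_one, ← Matrix.mulVec_mulVec, ← hz, pathMatrix_mulVec,
      ← Int.floor_sub_intCast, ← hLz i, ← hfz i]
    congr 1
    ring
  have hrefl : ∀ k ≤ n + 1, ∃ g : ℤ, f (n + 1 - k) = f k + g := fun k hk =>
    exists_reflection_eq_add_intCast hn h0 hlast (fun i => if h : i < n then c ⟨i, h⟩ else 0)
      (fun i hi => by rw [dif_pos hi]; exact hLz ⟨i, hi⟩) hk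
  obtain ⟨g₁, hg₁⟩ := hrefl 1 (by omega)
  have hrev : ∀ i : Fin n, ∃ g : ℤ, z i.rev = z i + g := fun i => by
    obtain ⟨g, hg⟩ := hrefl (i + 1) (by omega)
    refine ⟨g, ?_⟩
    rw [← hfz, ← hfz, ← hg, Fin.val_rev]
    congr 1
    omega
  choose g hg using hrev
  have hb : ∀ i : Fin n, ⌊4 * z i.rev⌋ = ⌊4 * z i⌋ + 4 * g i := fun i => by
    rw [hg, mul_add, show (4 * (g i : ℝ)) = ((4 * g i : ℤ) : ℝ) by push_cast; rfl,
      Int.floor_add_intCast]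
  have hWc : ∑ i : Fin n, (((i : ℕ) : ℝ) + 1) * c i =
      4 * ∑ i : Fin n, (((i : ℕ) : ℝ) + 1) * z i - (n + 1) * f n := by
    have h := sum_weighted_second_sum f n
    rw [hlast, h0, Finset.sum_range, Finset.sum_range] at h
    simp only [hLz] at h
    simp only [hfz] at h
    linarith
  have hC : ∑ i : Fin n, (c i : ℝ) = 4 * ∑ i : Fin n, z i - f n - f 1 := by
    have h := sum_second_sum f n
    rw [hlast, h0, Finset.sum_range, Finset.sum_range] at h
    simp only [hLz] at h
    simp only [hfz] at h
    linarith
  have hG : ∑ i : Fin n, (((i : ℕ) : ℝ) + 1) * g i =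
      (n + 1) * ∑ i : Fin n, z i - 2 * ∑ i : Fin n, (((i : ℕ) : ℝ) + 1) * z i := by
    have h := sum_weighted_comp_rev z
    simp only [hg, mul_add, Finset.sum_add_distrib] at h ⊢
    linarith
  have hB : ∑ i : Fin n, (((i : ℕ) : ℤ) + 1) * ⌊4 * z i⌋ +
      4 * ∑ i : Fin n, (((i : ℕ) : ℤ) + 1) * g i = (n + 1) * ∑ i : Fin n, ⌊4 * z i⌋ -
        ∑ i : Fin n, (((i : ℕ) : ℤ) + 1) * ⌊4 * z i⌋ := by
    rw [← sum_weighted_comp_rev (fun i => ⌊4 * z i⌋), Finset.mul_sum, ← Finset.sum_add_distrib]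
    refine Finset.sum_congr rfl fun i _ => ?_
    rw [hb]
    ring
  have hGc : 4 * ∑ i : Fin n, (((i : ℕ) : ℤ) + 1) * g i +
      2 * ∑ i : Fin n, (((i : ℕ) : ℤ) + 1) * c i = (n + 1) * (∑ i : Fin n, c i - g₁) := by
    rw [Nat.add_sub_cancel] at hg₁
    have h : (4 * ∑ i : Fin n, (((i : ℕ) : ℝ) + 1) * g i +
        2 * ∑ i : Fin n, (((i : ℕ) : ℝ) + 1) * c i) = (n + 1) * (∑ i : Fin n, (c i : ℝ) - g₁) := by
      rw [hG, hWc, hC]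
      linear_combination -((n : ℝ) + 1) * hg₁
    exact_mod_cast h
  -- As `n + 1` is odd, it suffices to treat twice the weighted sum, for which `hB` and `hGc`
  -- eliminate the terms coming from the reflection.
  have h2 : (n + 1 : ℤ) ∣ 2 * ∑ i : Fin n, (((i : ℕ) : ℤ) + 1) *
      ChipFiring.floorCoords (pathMatrix n 1) (pathMatrix n (-1)) c i := by
    refine ⟨∑ i : Fin n, ⌊4 * z i⌋ - ∑ i : Fin n, c i + g₁, ?_⟩
    simp only [hfloor, mul_sub, Finset.sum_sub_distrib]
    linear_combination hB - hGc
  refine IsCoprime.dvd_of_dvd_mul_left ?_ h2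
  obtain ⟨k, rfl⟩ := hn
  exact ⟨1, -k, by push_cast; ring⟩

theorem exists_pathMatrix_mulVec_eq_one (hn : Even n) :
    ∃ w, Matrix.mulVec (pathMatrix n (-1 : ℤ)) w = 1 := by
  obtain ⟨w, hw⟩ := exists_pathMatrix_mulVec_eq (n := n) (y := 1) (by
    have h : ∀ k : ℕ, 2 * ∑ i : Fin k, ((i : ℕ) + 1 : ℤ) * (1 : Fin k → ℤ) i = k * (k + 1) := by
      intro k
      induction k with
      | zero => simp
      | succ k ih =>
        rw [Fin.sum_univ_castSucc]
        simp only [Pi.one_apply, mul_one, Fin.val_castSucc, Fin.val_last] at ih ⊢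
        push_cast
        linarith
    obtain ⟨k, rfl⟩ := hn
    refine ⟨k, ?_⟩
    have := h (k + k)
    push_cast at this ⊢
    linarith)
  exact ⟨w, hw.symm⟩

end Path

/-! ### The Laplacians of the cycle -/

theorem cycleGraph_adj_castSucc {n : ℕ} (i j : Fin n) :
    (SimpleGraph.cycleGraph (n + 1)).Adj i.castSucc j.castSucc ↔
      (i : ℕ) + 1 = j ∨ (j : ℕ) + 1 = i := by
  have h : ∀ a b : Fin n, ((a.castSucc - b.castSucc : Fin (n + 1)) : ℕ) = 1 ↔
      (b : ℕ) + 1 = a := by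
    intro a b
    have ha := a.isLt
    have hb := b.isLt
    rw [Fin.sub_def]
    simp only [Fin.val_castSucc]
    rcases le_or_gt (b : ℕ) a with hle | hlt
    · rw [show n + 1 - (b : ℕ) + a = (a - b : ℕ) + (n + 1) by omega, Nat.add_mod_right,
        Nat.mod_eq_of_lt (by omega)]
      omega
    · rw [Nat.mod_eq_of_lt (by omega)]
      omega
  rw [SimpleGraph.cycleGraph_adj', h, h, or_comm]

namespace SignedGraph

theorem reducedLaplacian_of_cycleGraph {n : ℕ} (hn : 2 ≤ n) (S : SignedGraph (Fin (n + 1)))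
    (hS : S.graph = SimpleGraph.cycleGraph (n + 1)) (s : ℤ)
    (hs : ∀ (i j : Fin n) (h : S.graph.Adj i.castSucc j.castSucc),
      -((S.sign ⟨s(i.castSucc, j.castSucc), h⟩ : ℤˣ) : ℤ) = s) :
    S.reducedLaplacian = pathMatrix n s := by
  classical
  obtain ⟨k, rfl⟩ := Nat.exists_eq_add_of_le' hn
  ext i j
  have hadj : S.graph.Adj i.castSucc j.castSucc ↔ (i : ℕ) + 1 = j ∨ (j : ℕ) + 1 = i := by
    rw [hS, cycleGraph_adj_castSucc]
  simp only [reducedLaplacian, laplacian, Matrix.submatrix_apply, Matrix.of_apply, pathMatrix,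
    Fin.castSucc_inj]
  by_cases hij : i = j
  · rw [if_pos hij, if_pos hij]
    obtain ⟨G, σ⟩ := S
    obtain rfl : G = _ := hS
    have := SimpleGraph.cycleGraph_degree_three_le (v := i.castSucc)
    norm_cast
    convert this
  · rw [if_neg hij, if_neg hij]
    by_cases h : S.graph.Adj i.castSucc j.castSucc
    · rw [dif_pos h, if_pos (hadj.1 h), hs]
    · rw [dif_neg h, if_neg (mt hadj.2 h)]

theorem negativeCycle_reducedLaplacian {n : ℕ} (hn : 2 ≤ n) :
    (negativeCycle n).reducedLaplacian = pathMatrix n 1 := by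
  refine reducedLaplacian_of_cycleGraph hn _ rfl 1 fun i j h => ?_
  have : Fin.last n ∉ s(i.castSucc, j.castSucc) := by
    simp [Sym2.mem_iff, (Fin.castSucc_ne_last _).symm]
  simp [negativeCycle, negative, this]

theorem allPositive_cycleGraph_reducedLaplacian {n : ℕ} (hn : 2 ≤ n) :
    (allPositive (SimpleGraph.cycleGraph (n + 1))).reducedLaplacian = pathMatrix n (-1) :=
  reducedLaplacian_of_cycleGraph hn _ rfl (-1) fun _ _ _ => by simp [allPositive]

end SignedGraph

theorem mainTheorem7 (m : ℕ) (hm : 1 ≤ m) :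
    (∃! e : Fin (2 * m) → ℤ, (SignedGraph.negativeCycle (2 * m)).IsIdentity e) ∧
      ∀ e : Fin (2 * m) → ℤ, (SignedGraph.negativeCycle (2 * m)).IsIdentity e →
        Set.BijOn (fun c => e + c)
          {c | (SignedGraph.negativeCycle (2 * m)).IsZSuperstable c}
          {c | (SignedGraph.negativeCycle (2 * m)).IsCritical c} := by
  have hn : 2 ≤ 2 * m := by omega
  have hev : Even (2 * m) := even_two_mul m
  have hLdef := SignedGraph.negativeCycle_reducedLaplacian hn
  have hMdef : (SignedGraph.allPositive (SignedGraph.negativeCycle (2 * m)).graph).reducedLaplacian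
      = pathMatrix (2 * m) (-1) := SignedGraph.allPositive_cycleGraph_reducedLaplacian hn
  obtain ⟨w, hw⟩ := exists_pathMatrix_mulVec_eq_one hev
  simp only [SignedGraph.IsIdentity, SignedGraph.IsCritical, SignedGraph.IsZSuperstable,
    Submodule.Quotient.mk_eq_zero]
  rw [hLdef, hMdef]
  refine ChipFiring.existsUnique_and_bijOn ?_ ?_ pathMatrix_inversePositive
    (exists_floorCoords_eq_pathMatrix_mulVec hev) (fun i => by simp [pathMatrix]) ?_
    sum_pathMatrix_neg_one_nonneg hw
  · rw [pathMatrix_map_intCast, Int.cast_one]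
    exact pathMatrix_one_det_isUnit _
  · rw [pathMatrix_map_intCast, Int.cast_neg, Int.cast_one]
    exact pathMatrix_neg_one_det_isUnit _
  · intro i j hij
    simp only [pathMatrix, Matrix.of_apply, if_neg hij]
    split_ifs <;> norm_num
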